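/- Consider an exchange economy with $N\ge 1$ consumers and $K\ge 1$ goods, with total amounts $w\in\mathbb{R}^K$, $w_k>0$ for all $k$. Consumer $i$ has a utility function $u_i:\mathbb{R}^K_{\ge 0}\to\mathbb{R}$ that is strictly increasing ($x\le y$ and $x\ne y$ imply $u_i(x)<u_i(y)$), quasiconcave, continuous on $\mathbb{R}^K_{\ge0}$, and differentiable at every $x$ with all $x_k>0$. Let $\langle p|x\rangle=\sum_k p_kx_k$ and $$F(w)=\Big\{x\in\mathbb{R}^{NK}_{\ge 0}: \sum_i x_{ik}\le w_k\ \forall k\Big\},\quad \Sigma_K(w)=\{p\in\mathbb{R}^K_{\ge 0}:\langle p|w\rangle=1\},\quad \Sigma_N=\Big\{m\in\mathbb{R}^N_{\ge 0}:\sum_i m_i=1\Big\}.$$ Let $v_i(p,m_i)=\max\{u_i(y): y\in\mathbb{R}^K_{\ge 0},\ \langle p|y\rangle=m_i\}$ whenever this maximum exists, and put $$\mathrm{UPS}=\{(u_i(x_i))_{i}: x\in F(w)\},\qquad \mathrm{VPS}=\{(v_i(p,m_i))_{i}: p\in\Sigma_K(w),\ m\in\Sigma_N,\ \text{all } v_i(p,m_i)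 \text{ exist}\}.$$ An allocation $x\in F(w)$ is Pareto optimal if $(u_i(x_i))_i$ is a maximal element of $\mathrm{UPS}$ in the coordinatewise order. Given endowments $\omega_i\in\mathbb{R}^K_{\ge 0}$ with $\sum_i\omega_i=w$, a Walrasian equilibrium is a pair $(x,p)\in F(w)\times\Sigma_K(w)$ such that, for each $i$, $\langle p|x_i\rangle\le\langle p|\omega_i\rangle$ and $u_i(y)\le u_i(x_i)$ for every $y\in\mathbb{R}^K_{\ge0}$ with $\langle p|y\rangle\le\langle p|\omega_i\rangle$. Then: 1. For all such endowments there exists at least one Walrasian equilibrium, and every Walrasian equilibrium $(x,p)$ satisfies $(u_i(x_i))_i\in\mathrm{UPS}\cap\mathrm{VPS}$. 2. (First welfare theorem) For all such endowments, the allocation $x$ of every Walrasian equilibrium $(x,p)$ is Pareto optimal. 3. (Second welfare theorem) For every Pareto optimal allocation $x$ there are $m\in\Sigma_N$ and $p\in\Sigma_K(w)$ such that $(x,p)$ is a Walrasian equilibrium for the diagonal endowments $\omega_i=m_iw$. -/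

import Mathlib

namespace ExchangeEconomy

/-- Feasible allocations `F(w)`: consumer `i` receives the non-negative bundle `x i`, and for each
good `k` no more than the available amount `w k` is handed out. -/
def feasible {N K : ℕ} (w : Fin K → ℝ) : Set (Fin N → Fin K → ℝ) :=
  {x | (∀ i k, 0 ≤ x i k) ∧ ∀ k, ∑ i, x i k ≤ w k}

/-- Normalized prices `Σ_K(w)`: non-negative price vectors that give the aggregate endowment the
value one. -/
def prices {K : ℕ} (w : Fin K → ℝ) : Set (Fin K → ℝ) :=
  {p | (∀ k, 0 ≤ p k) ∧ p ⬝ᵥ w = 1}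

/-- `v` is the indirect utility at prices `p` and income `m` of a consumer with utility `u`, i.e.
`v = max {u y | y ≥ 0, ⟨p|y⟩ = m}`; the maximum has to be attained. -/
def IsIndirectUtility {K : ℕ} (u : (Fin K → ℝ) → ℝ) (p : Fin K → ℝ) (m v : ℝ) : Prop :=
  IsGreatest (u '' {y | 0 ≤ y ∧ p ⬝ᵥ y = m}) v

/-- The utility possibility set. -/
def UPS {N K : ℕ} (w : Fin K → ℝ) (u : Fin N → (Fin K → ℝ) → ℝ) : Set (Fin N → ℝ) :=
  {a | ∃ x ∈ feasible w, ∀ i, a i = u i (x i)}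

/-- The indirect utility possibility set: vectors of indirect utilities at normalized prices and
income distributions `m` (non-negative incomes that sum to one). -/
def VPS {N K : ℕ} (w : Fin K → ℝ) (u : Fin N → (Fin K → ℝ) → ℝ) : Set (Fin N → ℝ) :=
  {a | ∃ p ∈ prices w, ∃ m ∈ stdSimplex ℝ (Fin N), ∀ i, IsIndirectUtility (u i) p (m i) (a i)}

/-- A Pareto optimal allocation: a feasible allocation whose utility vector is a maximal element of
the utility possibility set, in the coordinatewise order. -/
def IsParetoOptimal {N K : ℕ} (w : Fin K → ℝ) (u : Fin N → (Fin K → ℝ) → ℝ)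
    (x : Fin N → Fin K → ℝ) : Prop :=
  x ∈ feasible w ∧ Maximal (· ∈ UPS w u) (fun i => u i (x i))

/-- `(x, p)` is a Walrasian equilibrium of the economy with utilities `u` and endowments `ω`
(of which the total is `w`): prices are normalized, the allocation is feasible, and each consumer's
bundle is affordable and is best among all affordable bundles. -/
structure IsWalrasianEquilibrium {N K : ℕ} (w : Fin K → ℝ) (u : Fin N → (Fin K → ℝ) → ℝ)
    (ω : Fin N → Fin K → ℝ) (x : Fin N → Fin K → ℝ) (p : Fin K → ℝ) : Prop where
  price_mem : p ∈ prices w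
  feasible_mem : x ∈ feasible w
  affordable : ∀ i, p ⬝ᵥ x i ≤ p ⬝ᵥ ω i
  optimal : ∀ i, ∀ y : Fin K → ℝ, 0 ≤ y → p ⬝ᵥ y ≤ p ⬝ᵥ ω i → u i y ≤ u i (x i)

end ExchangeEconomy

/-!
The heart of the matter is the existence of an equilibrium, which needs a fixed point theorem; it is
proved here from scratch. Scarf's lemma (`Scarf.exists_dominant_colourful`), a parity argument about
finite sets with several linear orders, takes the place of Sperner's lemma and of a triangulation.
Applied to the grid points of the simplex, ordered by their coordinates, it gives approximate fixed
points and hence Brouwer's theorem (`Brouwer.exists_fixedPoint`).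

For the passage from functions to correspondences no approximate selections are needed. If no price
clears the markets, then at each price `p` the compact convex set of excess demands is strictly
separated from the non-positive orthant by some price `q`; that same `q` works near `p`, and the
suitable `q` form a convex set, so a partition of unity gives a continuous map of the simplex whose
fixed points contradict Walras' law (`GaleDebreuNikaido.exists_nonpos`).

Demand may jump where a consumer's income vanishes, so the lemma is applied to the quasi-demand,
which only requires a bundle to be at least as good as those of value strictly below the income; its
graph is closed and its values are convex. Truncating the consumption sets at `w + w` makes it
compact, and the bound is not felt at an allocation of `w` (`le_of_mem_quasiDemand`). Since utilities
are strictly increasing and `w` is positive, quasi-equilibria are equilibria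
(`isWalrasianEquilibrium_of_quasi`). The same fact finishes the second welfare theorem: a hyperplane
separating `w` from the total bundles that allow an improvement of a Pareto optimum supports a
quasi-equilibrium.
-/

/-! ### Scarf's combinatorial lemma -/

namespace Scarf

variable {T I : Type*}

/-- The set `σ` is dominant with respect to the indices `C`, where `v i` is an injective ranking of
`T` that stands for the `i`-th linear order: no element of `T` beats, in all the orders from `C`
at once, the minimum of `σ` in that order. -/
def Dominant (v : I → T → ℕ) (σ : Finset T) (C : Finset I) : Prop :=
  ∀ y, ∃ i ∈ C, ∀ x ∈ σ, v i y ≤ v i x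

theorem Dominant.mono_left {v : I → T → ℕ} {σ τ : Finset T} {C : Finset I} (h : Dominant v σ C)
    (hτ : τ ⊆ σ) : Dominant v τ C := fun y => by
  obtain ⟨i, hi, h⟩ := h y
  exact ⟨i, hi, fun x hx => h x (hτ hx)⟩

theorem Dominant.mono_right {v : I → T → ℕ} {σ : Finset T} {C D : Finset I} (h : Dominant v σ C)
    (hD : C ⊆ D) : Dominant v σ D := fun y => by
  obtain ⟨i, hi, h⟩ := h y
  exact ⟨i, hD hi, h⟩

variable [DecidableEq T] [DecidableEq I]

/-- The pair `d = (τ, D)` is a door of the pair `r = (σ, C)`: either `σ` has one more point and the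
same indices, or the same points and one index less. -/
def IsDoorOf (d r : Finset T × Finset I) : Prop :=
  (∃ x, x ∉ d.1 ∧ r = (insert x d.1, d.2)) ∨ ∃ j ∈ d.2, r = (d.1, d.2.erase j)

/-- If the minima of `τ` in the orders from `D.erase j` exhaust `τ`, there is exactly one
dominant pair having `(τ, D)` as a door in which the index `j` is dropped or becomes the index of
the new point. -/
theorem existsUnique_room [Fintype T] {v : I → T → ℕ} (hv : ∀ i, Function.Injective (v i))
    {τ : Finset T} {D : Finset I} (hd : Dominant v τ D) {m : I → T}
    (hm : ∀ i, m i ∈ τ ∧ ∀ x ∈ τ, v i (m i) ≤ v i x) {j : I} (hj : j ∈ D)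
    (him : (D.erase j).image m = τ) :
    ∃! r : Finset T × Finset I, Dominant v r.1 r.2 ∧
      (r = (τ, D.erase j) ∨
        ∃ x, x ∉ τ ∧ (∀ i ∈ D.erase j, v i (m i) < v i x) ∧ r = (insert x τ, D)) := by
  classical
  set M : Finset T := Finset.univ.filter fun y => ∀ i ∈ D.erase j, v i (m i) < v i y with hM
  have memM : ∀ y, y ∈ M ↔ ∀ i ∈ D.erase j, v i (m i) < v i y := by simp [hM]
  have hMτ : ∀ y ∈ M, y ∉ τ := by
    intro y hy hyτ
    rw [← him, Finset.mem_image] at hyτ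
    obtain ⟨i, hi, rfl⟩ := hyτ
    exact lt_irrefl _ ((memM _).1 hy i hi)
  rcases M.eq_empty_or_nonempty with hE | hne
  · refine ⟨(τ, D.erase j), ⟨?_, Or.inl rfl⟩, ?_⟩
    · intro y
      have hy : y ∉ M := by simp [hE]
      rw [memM] at hy
      push Not at hy
      obtain ⟨i, hi, h⟩ := hy
      exact ⟨i, hi, fun x hx => h.trans ((hm i).2 x hx)⟩
    · rintro r ⟨-, rfl | ⟨x, -, hx, rfl⟩⟩
      · rfl
      · have : x ∈ M := (memM x).2 hx
        simp [hE] at this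
  · obtain ⟨x, hxM, hxmax⟩ := M.exists_max_image (v j) hne
    have hx := (memM x).1 hxM
    have hxj : v j x ≤ v j (m j) := by
      obtain ⟨i, hi, h⟩ := hd x
      by_cases hij : i = j
      · subst hij; exact h _ (hm i).1
      · exact absurd (h _ (hm i).1) (not_le.2 (hx i (Finset.mem_erase.2 ⟨hij, hi⟩)))
    refine ⟨(insert x τ, D), ⟨?_, Or.inr ⟨x, hMτ x hxM, hx, rfl⟩⟩, ?_⟩
    · intro y
      by_cases hy : y ∈ M
      · refine ⟨j, hj, fun z hz => ?_⟩
        rcases Finset.mem_insert.1 hz with rfl | hz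
        · exact hxmax y hy
        · exact (hxmax y hy).trans (hxj.trans ((hm j).2 z hz))
      · rw [memM] at hy
        push Not at hy
        obtain ⟨i, hi, h⟩ := hy
        refine ⟨i, Finset.mem_of_mem_erase hi, fun z hz => ?_⟩
        rcases Finset.mem_insert.1 hz with rfl | hz
        · exact h.trans (hx i hi).le
        · exact h.trans ((hm i).2 z hz)
    · rintro r ⟨hr, rfl | ⟨x', -, hx', rfl⟩⟩
      · obtain ⟨i, hi, h⟩ := hr x
        exact absurd (h _ (hm i).1) (not_le.2 (hx i hi))
      · have h1 : v j x' ≤ v j x := hxmax x' ((memM x').2 hx')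
        obtain ⟨i, hi, h⟩ := hr x
        by_cases hij : i = j
        · subst hij
          have h2 := h x' (Finset.mem_insert_self _ _)
          rw [hv i (le_antisymm h1 h2)]
        · exact absurd (h _ (Finset.mem_insert_of_mem (hm i).1))
            (not_le.2 (hx i (Finset.mem_erase.2 ⟨hij, hi⟩)))

/-- A dominant pair `(τ, D)` with `τ` non-empty and one index in excess is a door of exactly two
dominant pairs: the map sending an index of `D` to the corresponding minimum of `τ` is onto, so it
identifies a single pair of indices, and each of these gives one room. -/
theorem exists_two_rooms [Fintype T] {v : I → T → ℕ} (hv : ∀ i, Function.Injective (v i))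
    {τ : Finset T} {D : Finset I} (hd : Dominant v τ D) (hτ : τ.Nonempty)
    (hcard : D.card = τ.card + 1) :
    ∃ r s : Finset T × Finset I, r ≠ s ∧
      ∀ q, (Dominant v q.1 q.2 ∧ IsDoorOf (τ, D) q) ↔ q = r ∨ q = s := by
  choose m hmτ hmin using fun i => τ.exists_min_image (v i) hτ
  have meq : ∀ i, ∀ y ∈ τ, (∀ x ∈ τ, v i y ≤ v i x) → m i = y := fun i y hy h =>
    hv i (le_antisymm (hmin i y hy) (h _ (hmτ i)))
  obtain ⟨j, hj, k, hk, hjk, hmjk⟩ := Finset.exists_ne_map_eq_of_card_lt_of_maps_to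
    (s := D) (t := τ) (f := m) (by omega) (fun i _ => hmτ i)
  have himD : ∀ y ∈ τ, ∃ i ∈ D, m i = y := fun y hy => by
    obtain ⟨i, hi, h⟩ := hd y
    exact ⟨i, hi, meq i y hy h⟩
  have himj : (D.erase j).image m = τ := by
    refine Finset.Subset.antisymm (Finset.image_subset_iff.2 fun i _ => hmτ i) fun y hy => ?_
    obtain ⟨i, hi, rfl⟩ := himD y hy
    rw [Finset.mem_image]
    by_cases hij : i = j
    · exact ⟨k, Finset.mem_erase.2 ⟨hjk.symm, hk⟩, by rw [hij, hmjk]⟩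
    · exact ⟨i, Finset.mem_erase.2 ⟨hij, hi⟩, rfl⟩
  have himk : (D.erase k).image m = τ := by
    refine Finset.Subset.antisymm (Finset.image_subset_iff.2 fun i _ => hmτ i) fun y hy => ?_
    obtain ⟨i, hi, rfl⟩ := himD y hy
    rw [Finset.mem_image]
    by_cases hij : i = k
    · exact ⟨j, Finset.mem_erase.2 ⟨hjk, hj⟩, by rw [hij, hmjk]⟩
    · exact ⟨i, Finset.mem_erase.2 ⟨hij, hi⟩, rfl⟩
  have honly : ∀ l ∈ D, (∀ y ∈ τ, ∃ i ∈ D.erase l, m i = y) → l = j ∨ l = k := by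
    intro l hl h
    by_contra hne
    push Not at hne
    have hcl : τ.card ≤ ((D.erase l).erase j).card := by
      refine (Finset.card_le_card fun y hy => ?_).trans (Finset.card_image_le (f := m))
      obtain ⟨i, hi, rfl⟩ := h y hy
      rw [Finset.mem_image]
      by_cases hij : i = j
      · exact ⟨k, Finset.mem_erase.2 ⟨hjk.symm, Finset.mem_erase.2 ⟨hne.2.symm, hk⟩⟩,
          by rw [hij, hmjk]⟩
      · exact ⟨i, Finset.mem_erase.2 ⟨hij, hi⟩, rfl⟩
    have hpos := Finset.card_pos.2 ⟨l, hl⟩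
    rw [Finset.card_erase_of_mem (Finset.mem_erase.2 ⟨hne.1.symm, hj⟩),
      Finset.card_erase_of_mem hl] at hcl
    have := hτ.card_pos
    omega
  obtain ⟨r, ⟨hr, hr'⟩, hru⟩ := existsUnique_room hv hd (fun i => ⟨hmτ i, hmin i⟩) hj himj
  obtain ⟨s, ⟨hs, hs'⟩, hsu⟩ := existsUnique_room hv hd (fun i => ⟨hmτ i, hmin i⟩) hk himk
  refine ⟨r, s, ?_, fun q => ⟨?_, ?_⟩⟩
  · rintro rfl
    rcases hr' with rfl | ⟨x, hxτ, hx, rfl⟩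
    · rcases hs' with h | ⟨y, hyτ, -, h⟩
      · have h2 := (Prod.ext_iff.1 h).2
        have : k ∈ D.erase j := Finset.mem_erase.2 ⟨hjk.symm, hk⟩
        simp only at h2
        rw [h2] at this
        simp at this
      · have h1 : τ = insert y τ := (Prod.ext_iff.1 h).1
        exact hyτ (h1.symm ▸ Finset.mem_insert_self y τ)
    · rcases hs' with h | ⟨y, hyτ, hy, h⟩
      · have h1 : insert x τ = τ := (Prod.ext_iff.1 h).1
        exact hxτ (h1 ▸ Finset.mem_insert_self x τ)
      · have hxy : x = y := by
          have h1 := (Prod.ext_iff.1 h).1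
          simp only at h1
          have : x ∈ insert y τ := h1 ▸ Finset.mem_insert_self x τ
          exact (Finset.mem_insert.1 this).resolve_right hxτ
        subst hxy
        -- `x` would lie strictly above the minimum of `τ` in every order
        obtain ⟨i, hi, h⟩ := hr x
        have h2 := h (m i) (Finset.mem_insert_of_mem (hmτ i))
        by_cases hij : i = j
        · exact absurd h2 (not_le.2 (hy i (Finset.mem_erase.2 ⟨hij ▸ hjk, hi⟩)))
        · exact absurd h2 (not_le.2 (hx i (Finset.mem_erase.2 ⟨hij, hi⟩)))
  · rintro ⟨hq, ⟨x, hxτ, rfl⟩ | ⟨l, hl, rfl⟩⟩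
    · obtain ⟨l, hl, hxl⟩ := hq x
      simp only at hl hxl
      have hmem : ∀ y ∈ τ, ∃ i ∈ D.erase l, m i = y ∧ v i y < v i x := by
        intro y hy
        obtain ⟨i, hi, h⟩ := hq y
        have hyx : v i y < v i x := lt_of_le_of_ne (h x (Finset.mem_insert_self _ _))
          fun h' => hxτ (hv i h' ▸ hy)
        refine ⟨i, Finset.mem_erase.2 ⟨?_, hi⟩,
          meq i y hy fun z hz => h z (Finset.mem_insert_of_mem hz), hyx⟩
        rintro rfl
        exact absurd (hxl y (Finset.mem_insert_of_mem hy)) (not_le.2 hyx)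
      have hlt : ∀ i ∈ D.erase l, v i (m i) < v i x := by
        have hsurj : Set.SurjOn m (D.erase l) τ := fun y hy => by
          obtain ⟨i, hi, h, -⟩ := hmem y hy
          exact ⟨i, hi, h⟩
        have hinj : Set.InjOn m (D.erase l) := Finset.injOn_of_surjOn_of_card_le m
          (fun i _ => hmτ i) hsurj (by rw [Finset.card_erase_of_mem hl, hcard]; omega)
        intro i hi
        obtain ⟨i', hi', h, h'⟩ := hmem (m i) (hmτ i)
        rwa [hinj hi' hi h] at h'
      rcases honly l hl (fun y hy => (hmem y hy).imp fun i h => ⟨h.1, h.2.1⟩) with rfl | rfl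
      · exact Or.inl (hru _ ⟨hq, Or.inr ⟨x, hxτ, hlt, rfl⟩⟩)
      · exact Or.inr (hsu _ ⟨hq, Or.inr ⟨x, hxτ, hlt, rfl⟩⟩)
    · have hsur : ∀ y ∈ τ, ∃ i ∈ D.erase l, m i = y := fun y hy => by
        obtain ⟨i, hi, h⟩ := hq y
        exact ⟨i, hi, meq i y hy h⟩
      rcases honly l hl hsur with rfl | rfl
      · exact Or.inl (hru _ ⟨hq, Or.inl rfl⟩)
      · exact Or.inr (hsu _ ⟨hq, Or.inl rfl⟩)
  · rintro (rfl | rfl)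
    · refine ⟨hr, ?_⟩
      rcases hr' with rfl | ⟨x, hx, -, rfl⟩
      · exact Or.inr ⟨j, hj, rfl⟩
      · exact Or.inl ⟨x, hx, rfl⟩
    · refine ⟨hs, ?_⟩
      rcases hs' with rfl | ⟨x, hx, -, rfl⟩
      · exact Or.inr ⟨k, hk, rfl⟩
      · exact Or.inl ⟨x, hx, rfl⟩

/-- The pair `({max}, {i})`, where the maximum is taken in the `i`-th order, is the only dominant
pair that has the door `(∅, {i})`. -/
theorem existsUnique_room_of_empty [Fintype T] [Nonempty T] {v : I → T → ℕ}
    (hv : ∀ i, Function.Injective (v i)) (i : I) :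
    ∃ r : Finset T × Finset I, ∀ q, (Dominant v q.1 q.2 ∧ IsDoorOf (∅, {i}) q) ↔ q = r := by
  obtain ⟨x, -, hx⟩ := (Finset.univ : Finset T).exists_max_image (v i) Finset.univ_nonempty
  refine ⟨({x}, {i}), fun q => ⟨?_, ?_⟩⟩
  · rintro ⟨hq, ⟨y, -, rfl⟩ | ⟨j, hj, rfl⟩⟩
    · obtain ⟨k, hk, h⟩ := hq x
      rw [Finset.mem_singleton] at hk
      subst hk
      have := h y (by simp)
      rw [hv k (le_antisymm this (hx y (Finset.mem_univ _)))]
      rfl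
    · rw [Finset.mem_singleton] at hj
      subst hj
      obtain ⟨k, hk, -⟩ := hq x
      simp at hk
  · rintro rfl
    refine ⟨fun y => ⟨i, by simp, fun z hz => ?_⟩, Or.inl ⟨x, by simp, rfl⟩⟩
    rw [Finset.mem_singleton.1 hz]
    exact hx y (Finset.mem_univ _)

/-- A pair is of type `i` for the colouring `c` if `i` is the one index that is not a colour. -/
def IsTyped (c : T → I) (i : I) (d : Finset T × Finset I) : Prop :=
  i ∈ d.2 ∧ d.1.image c = d.2.erase i

/-- `IsDoorOf` seen from the room: a point is removed or an index is added. -/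
theorem isDoorOf_iff {d : Finset T × Finset I} {σ : Finset T} {C : Finset I} :
    IsDoorOf d (σ, C) ↔
      (∃ y ∈ σ, d = (σ.erase y, C)) ∨ ∃ j, j ∉ C ∧ d = (σ, insert j C) := by
  obtain ⟨τ, D⟩ := d
  simp only [IsDoorOf, Prod.mk.injEq]
  constructor
  · rintro (⟨x, hx, rfl, rfl⟩ | ⟨j, hj, rfl, rfl⟩)
    · exact Or.inl ⟨x, Finset.mem_insert_self _ _, (Finset.erase_insert hx).symm, rfl⟩
    · exact Or.inr ⟨j, by simp, rfl, (Finset.insert_erase hj).symm⟩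
  · rintro (⟨x, hx, rfl, rfl⟩ | ⟨j, hj, rfl, rfl⟩)
    · exact Or.inl ⟨x, by simp, (Finset.insert_erase hx).symm, rfl⟩
    · exact Or.inr ⟨j, Finset.mem_insert_self _ _, rfl, (Finset.erase_insert hj).symm⟩

/-- Two of the points of `σ` share a colour: the doors of type `i` are obtained by removing one of
the two. -/
theorem typed_doors_of_image_eq {c : T → I} {i : I} {σ : Finset T} {C : Finset I}
    (hcard : σ.card = C.card) (hi : i ∈ C) (him : σ.image c = C.erase i) :
    ∃ d e : Finset T × Finset I, d ≠ e ∧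
      ∀ q, (IsDoorOf q (σ, C) ∧ IsTyped c i q) ↔ q = d ∨ q = e := by
  have hpos := Finset.card_pos.2 ⟨i, hi⟩
  have hci : (C.erase i).card = C.card - 1 := Finset.card_erase_of_mem hi
  obtain ⟨x, hx, y, hy, hxy, hcxy⟩ := Finset.exists_ne_map_eq_of_card_lt_of_maps_to
    (s := σ) (t := C.erase i) (f := c) (by omega)
    (fun z hz => him ▸ Finset.mem_image_of_mem c hz)
  have key : ∀ a ∈ σ, ∀ b ∈ σ, a ≠ b → c a = c b → (σ.erase a).image c = C.erase i := by
    intro a ha b hb hab hcab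
    rw [← him]
    refine Finset.Subset.antisymm (Finset.image_subset_image (Finset.erase_subset _ _))
      fun z hz => ?_
    obtain ⟨t, ht, rfl⟩ := Finset.mem_image.1 hz
    by_cases hta : t = a
    · exact Finset.mem_image.2 ⟨b, Finset.mem_erase.2 ⟨hab.symm, hb⟩, by rw [hta, hcab]⟩
    · exact Finset.mem_image_of_mem c (Finset.mem_erase.2 ⟨hta, ht⟩)
  refine ⟨(σ.erase x, C), (σ.erase y, C), ?_, fun q => ⟨?_, ?_⟩⟩
  · intro h
    have h1 : σ.erase x = σ.erase y := (Prod.ext_iff.1 h).1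
    have : y ∈ σ.erase x := Finset.mem_erase.2 ⟨hxy.symm, hy⟩
    rw [h1] at this
    simp at this
  · rintro ⟨hq, hq1, hq2⟩
    rcases isDoorOf_iff.1 hq with ⟨z, hz, rfl⟩ | ⟨j, hj, rfl⟩
    · by_contra hne
      have hzx : x ≠ z := by rintro rfl; simp at hne
      have hzy : y ≠ z := by rintro rfl; simp at hne
      have hinj : Set.InjOn c (σ.erase z) := by
        rw [← Finset.card_image_iff, hq2, Finset.card_erase_of_mem hz, hci, hcard]
      exact hxy (hinj (Finset.mem_erase.2 ⟨hzx, hx⟩) (Finset.mem_erase.2 ⟨hzy, hy⟩) hcxy)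
    · have hji : j ≠ i := by rintro rfl; exact hj hi
      have h3 : C.erase i = (insert j C).erase i := him.symm.trans hq2
      have : j ∈ (insert j C).erase i := Finset.mem_erase.2 ⟨hji, Finset.mem_insert_self _ _⟩
      rw [← h3] at this
      exact absurd (Finset.mem_of_mem_erase this) hj
  · rintro (rfl | rfl)
    · exact ⟨isDoorOf_iff.2 (Or.inl ⟨x, hx, rfl⟩), hi, key x hx y hy hxy hcxy⟩
    · exact ⟨isDoorOf_iff.2 (Or.inl ⟨y, hy, rfl⟩), hi, key y hy x hx hxy.symm hcxy.symm⟩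

/-- One of the points of `σ` has a colour `a` outside `C`: the doors of type `i` are obtained by
removing that point or by adding the index `a`. -/
theorem typed_doors_of_image_eq_insert {c : T → I} {i a : I} {σ : Finset T} {C : Finset I}
    (hcard : σ.card = C.card) (hi : i ∈ C) (ha : a ∉ C)
    (him : σ.image c = insert a (C.erase i)) :
    ∃ d e : Finset T × Finset I, d ≠ e ∧
      ∀ q, (IsDoorOf q (σ, C) ∧ IsTyped c i q) ↔ q = d ∨ q = e := by
  have hai : a ≠ i := by rintro rfl; exact ha hi
  have haC : a ∉ C.erase i := fun h => ha (Finset.mem_of_mem_erase h)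
  have hpos := Finset.card_pos.2 ⟨i, hi⟩
  have hinj : Set.InjOn c σ := by
    rw [← Finset.card_image_iff, him, Finset.card_insert_of_notMem haC,
      Finset.card_erase_of_mem hi]
    omega
  obtain ⟨x, hx, rfl⟩ := Finset.mem_image.1 (him ▸ Finset.mem_insert_self a (C.erase i))
  refine ⟨(σ.erase x, C), (σ, insert (c x) C), ?_, fun q => ⟨?_, ?_⟩⟩
  · intro h
    have h1 : C = insert (c x) C := (Prod.ext_iff.1 h).2
    exact ha (h1.symm ▸ Finset.mem_insert_self _ _)
  · rintro ⟨hq, hq1, hq2⟩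
    rcases isDoorOf_iff.1 hq with ⟨z, hz, rfl⟩ | ⟨j, hj, rfl⟩
    · left
      by_cases hzx : x = z
      · rw [hzx]
      · have : c x ∈ (σ.erase z).image c :=
          Finset.mem_image_of_mem c (Finset.mem_erase.2 ⟨hzx, hx⟩)
        rw [hq2] at this
        exact absurd this haC
    · right
      have : c x ∈ (insert j C).erase i := by
        have h3 : σ.image c = (insert j C).erase i := hq2
        rw [← h3]
        exact Finset.mem_image_of_mem c hx
      rcases Finset.mem_insert.1 (Finset.mem_of_mem_erase this) with h | h
      · rw [h]
      · exact absurd h ha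
  · rintro (rfl | rfl)
    · refine ⟨isDoorOf_iff.2 (Or.inl ⟨x, hx, rfl⟩), hi, ?_⟩
      have h1 : (σ.erase x).image c = (σ.image c).erase (c x) := by
        ext b
        simp only [Finset.mem_image, Finset.mem_erase]
        constructor
        · rintro ⟨t, ⟨htx, ht⟩, rfl⟩
          exact ⟨fun h => htx (hinj ht hx h), t, ht, rfl⟩
        · rintro ⟨hb, t, ht, rfl⟩
          exact ⟨t, ⟨fun h => hb (h ▸ rfl), ht⟩, rfl⟩
      change (σ.erase x).image c = C.erase i
      rw [h1, him, Finset.erase_insert haC]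
    · refine ⟨isDoorOf_iff.2 (Or.inr ⟨c x, ha, rfl⟩), Finset.mem_insert_of_mem hi, ?_⟩
      change σ.image c = (insert (c x) C).erase i
      rw [him, Finset.erase_insert_of_ne hai]

/-- A room that is not colourful has no doors of type `i`, or exactly two. -/
theorem typed_doors_of_not_colourful {c : T → I} {i : I} {σ : Finset T} {C : Finset I}
    (hcard : σ.card = C.card) (hc : σ.image c ≠ C) :
    (∀ q, ¬(IsDoorOf q (σ, C) ∧ IsTyped c i q)) ∨
    ∃ d e : Finset T × Finset I, d ≠ e ∧
      ∀ q, (IsDoorOf q (σ, C) ∧ IsTyped c i q) ↔ q = d ∨ q = e := by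
  rw [or_iff_not_imp_left]
  intro h
  push Not at h
  obtain ⟨q, hq, hq1, hq2⟩ := h
  rcases isDoorOf_iff.1 hq with ⟨x, hx, rfl⟩ | ⟨j, hj, rfl⟩
  · replace hq1 : i ∈ C := hq1
    replace hq2 : (σ.erase x).image c = C.erase i := hq2
    have him : σ.image c = insert (c x) (C.erase i) := by
      rw [← hq2, ← Finset.image_insert, Finset.insert_erase hx]
    by_cases hxi : c x = i
    · rw [hxi, Finset.insert_erase hq1] at him
      exact absurd him hc
    by_cases hxC : c x ∈ C
    · rw [Finset.insert_eq_of_mem (Finset.mem_erase.2 ⟨hxi, hxC⟩)] at him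
      exact typed_doors_of_image_eq hcard hq1 him
    · exact typed_doors_of_image_eq_insert hcard hq1 hxC him
  · replace hq1 : i ∈ insert j C := hq1
    replace hq2 : σ.image c = (insert j C).erase i := hq2
    by_cases hji : j = i
    · rw [hji] at hq2 hj
      rw [Finset.erase_insert hj] at hq2
      exact absurd hq2 hc
    · rw [Finset.erase_insert_of_ne hji] at hq2
      exact typed_doors_of_image_eq_insert hcard
        ((Finset.mem_insert.1 hq1).resolve_left (Ne.symm hji)) hj hq2

/-- **Scarf's lemma**: for any colouring of a finite set with finitely many linear orders by their
indices there is a set that is dominant with respect to the set of its colours. Otherwise, for a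
fixed index `i`, every room has an even number of doors of type `i` and each such door belongs to
two rooms, except that `(∅, {i})` belongs to one only, which contradicts double counting. -/
theorem exists_dominant_colourful [Fintype T] [Nonempty T] [Fintype I] {v : I → T → ℕ}
    (hv : ∀ i, Function.Injective (v i)) (c : T → I) :
    ∃ σ : Finset T, Dominant v σ (σ.image c) := by
  classical
  by_contra! hno
  obtain ⟨t⟩ := ‹Nonempty T›
  set i := c t
  set A : Finset (Finset T × Finset I) := Finset.univ.filter fun d =>
    Dominant v d.1 d.2 ∧ d.2.card = d.1.card + 1 ∧ IsTyped c i d with hA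
  set B : Finset (Finset T × Finset I) := Finset.univ.filter fun r =>
    Dominant v r.1 r.2 ∧ r.1.card = r.2.card with hB
  have hcount := Finset.sum_card_bipartiteAbove_eq_sum_card_bipartiteBelow
    (s := A) (t := B) (fun d r => IsDoorOf d r)
  have hcardB : ∀ d r : Finset T × Finset I, d.2.card = d.1.card + 1 → IsDoorOf d r →
      r.1.card = r.2.card := by
    rintro ⟨τ, D⟩ r hd (⟨x, hx, rfl⟩ | ⟨j, hj, rfl⟩)
    · simp only at hx hd ⊢
      rw [Finset.card_insert_of_notMem hx, hd]
    · simp only at hj hd ⊢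
      rw [Finset.card_erase_of_mem hj, hd, Nat.add_sub_cancel]
  have hdoor : ∀ d r : Finset T × Finset I, r ∈ B → IsDoorOf d r →
      Dominant v d.1 d.2 ∧ d.2.card = d.1.card + 1 := by
    rintro d ⟨σ, C⟩ hr hdr
    obtain ⟨hr1, hr2⟩ := (Finset.mem_filter.1 hr).2
    rcases isDoorOf_iff.1 hdr with ⟨x, hx, rfl⟩ | ⟨j, hj, rfl⟩
    · refine ⟨hr1.mono_left (Finset.erase_subset _ _), ?_⟩
      have := Finset.card_pos.2 ⟨x, hx⟩
      simp only at hr2 ⊢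
      rw [Finset.card_erase_of_mem hx]
      omega
    · refine ⟨hr1.mono_right (Finset.subset_insert _ _), ?_⟩
      simp only at hr2 ⊢
      rw [Finset.card_insert_of_notMem hj, hr2]
  have hevenB : Even (∑ r ∈ B, (A.bipartiteBelow (fun d r => IsDoorOf d r) r).card) := by
    refine Finset.even_sum _ fun r hr => ?_
    obtain ⟨σ, C⟩ := r
    obtain ⟨hr1, hr2⟩ := (Finset.mem_filter.1 hr).2
    have hmem : ∀ q, q ∈ A.bipartiteBelow (fun d r => IsDoorOf d r) (σ, C) ↔
        IsDoorOf q (σ, C) ∧ IsTyped c i q := by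
      intro q
      simp only [Finset.mem_bipartiteBelow, hA, Finset.mem_filter, Finset.mem_univ, true_and]
      constructor
      · exact fun h => ⟨h.2, h.1.2.2⟩
      · exact fun h => ⟨⟨(hdoor q _ hr h.1).1, (hdoor q _ hr h.1).2, h.2⟩, h.1⟩
    rcases typed_doors_of_not_colourful (i := i) hr2 (fun h => hno σ (h.symm ▸ hr1)) with
      h | ⟨d, e, hde, h⟩
    · rw [Finset.card_eq_zero.2 (Finset.eq_empty_of_forall_notMem fun q hq => h q ((hmem q).1 hq))]
      exact Even.zero
    · have : A.bipartiteBelow (fun d r => IsDoorOf d r) (σ, C) = {d, e} := by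
        ext q; rw [hmem, h]; simp
      rw [this, Finset.card_pair hde]
      exact even_two
  have hmemA : ∀ d ∈ A, ∀ q, q ∈ B.bipartiteAbove (fun d r => IsDoorOf d r) d ↔
      Dominant v q.1 q.2 ∧ IsDoorOf d q := by
    intro d hd q
    simp only [Finset.mem_bipartiteAbove, hB, Finset.mem_filter, Finset.mem_univ, true_and]
    exact ⟨fun h => ⟨h.1.1, h.2⟩,
      fun h => ⟨⟨h.1, hcardB d q (Finset.mem_filter.1 hd).2.2.1 h.2⟩, h.2⟩⟩
  have hout : ((∅, {i}) : Finset T × Finset I) ∈ A :=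
    Finset.mem_filter.2 ⟨Finset.mem_univ _, fun _ => ⟨i, by simp, by simp⟩, by simp, by simp,
      by simp⟩
  have hodd : Odd (∑ d ∈ A, (B.bipartiteAbove (fun d r => IsDoorOf d r) d).card) := by
    rw [← Finset.add_sum_erase _ _ hout]
    refine Odd.add_even ?_ (Finset.even_sum _ fun d hd => ?_)
    · obtain ⟨r, hr⟩ := existsUnique_room_of_empty hv i
      have : B.bipartiteAbove (fun d r => IsDoorOf d r) (∅, {i}) = {r} := by
        ext q; rw [hmemA _ hout, hr]; simp
      rw [this, Finset.card_singleton]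
      exact odd_one
    · obtain ⟨hne, hdA⟩ := Finset.mem_erase.1 hd
      obtain ⟨τ, D⟩ := d
      obtain ⟨hd1, hd2, hd3, hd4⟩ := (Finset.mem_filter.1 hdA).2
      simp only at hd1 hd2 hd3 hd4
      have hτ : τ.Nonempty := by
        rw [Finset.nonempty_iff_ne_empty]
        rintro rfl
        rw [Finset.image_empty, eq_comm, Finset.erase_eq_empty_iff] at hd4
        rcases hd4 with rfl | rfl
        · simp at hd3
        · exact hne rfl
      obtain ⟨r, s, hrs, h⟩ := exists_two_rooms hv hd1 hτ hd2
      have : B.bipartiteAbove (fun d r => IsDoorOf d r) (τ, D) = {r, s} := by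
        ext q; rw [hmemA _ hdA, h]; simp
      rw [this, Finset.card_pair hrs]
      exact even_two
  rw [hcount] at hodd
  exact Nat.not_even_iff_odd.2 hodd hevenB

end Scarf

/-! ### Brouwer's fixed point theorem on the simplex -/

namespace Brouwer

variable {ι : Type*} [Fintype ι]

/-- The points with integral coordinates of the simplex scaled by `n`. -/
abbrev Grid (ι : Type*) [Fintype ι] (n : ℕ) : Type _ :=
  {a : ι → Fin (n + 1) // ∑ i, (a i : ℕ) = n}

/-- The ranking of grid points by their `i`-th coordinate, ties being broken by an enumeration. -/
noncomputable def rank {n : ℕ} [DecidableEq ι] (i : ι) (a : Grid ι n) : ℕ :=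
  (a.1 i : ℕ) * Fintype.card (Grid ι n) + Fintype.equivFin (Grid ι n) a

theorem rank_injective {n : ℕ} [DecidableEq ι] (i : ι) :
    Function.Injective (rank (n := n) i) := by
  intro a b h
  have ha := (Fintype.equivFin (Grid ι n) a).isLt
  have hb := (Fintype.equivFin (Grid ι n) b).isLt
  have h' := congrArg (· % Fintype.card (Grid ι n)) h
  simp only [rank, Nat.mul_add_mod_self_right, Nat.mod_eq_of_lt ha, Nat.mod_eq_of_lt hb] at h'
  exact (Fintype.equivFin (Grid ι n)).injective (Fin.ext h')

theorem le_of_rank_le {n : ℕ} [DecidableEq ι] {i : ι} {a b : Grid ι n}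
    (h : rank i a ≤ rank i b) : (a.1 i : ℕ) ≤ b.1 i := by
  by_contra! hlt
  have hb := (Fintype.equivFin (Grid ι n) b).isLt
  have := Nat.mul_le_mul_right (Fintype.card (Grid ι n)) (Nat.succ_le_of_lt hlt)
  rw [Nat.succ_mul] at this
  simp only [rank] at h
  omega

/-- If `σ` is dominant for the indices `C`, the minima over `σ` of the coordinates in `C` nearly
add up to `n`, as otherwise a grid point would exceed all of them. -/
theorem sum_min_of_dominant {n : ℕ} [DecidableEq ι] {σ : Finset (Grid ι n)} {C : Finset ι}
    (h : Scarf.Dominant rank σ C) (hC : C.Nonempty) {μ : ι → Grid ι n} (hμ : ∀ i, μ i ∈ σ) :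
    n < ∑ i ∈ C, ((μ i).1 i : ℕ) + C.card := by
  by_contra! hle
  obtain ⟨i₀, hi₀⟩ := hC
  set S := ∑ i ∈ C, ((μ i).1 i : ℕ) + C.card
  let y : ι → ℕ := fun i =>
    if i ∈ C then ((μ i).1 i : ℕ) + 1 + (if i = i₀ then n - S else 0) else 0
  have hy : ∑ i, y i = n := by
    simp only [y]
    rw [Finset.sum_ite_mem, Finset.univ_inter, Finset.sum_add_distrib, Finset.sum_add_distrib,
      Finset.sum_ite_eq_of_mem' _ _ _ hi₀, Finset.sum_const, smul_eq_mul, mul_one]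
    omega
  have hyn : ∀ i, y i < n + 1 := fun i =>
    Nat.lt_succ_of_le (hy ▸ Finset.single_le_sum (fun j _ => Nat.zero_le (y j)) (Finset.mem_univ i))
  obtain ⟨i, hi, hle⟩ := h ⟨fun i => ⟨y i, hyn i⟩, hy⟩
  have h1 := le_of_rank_le (hle _ (hμ i))
  simp only [y, if_pos hi] at h1
  omega

/-- The grid points of a set that is dominant for `C` are close to each other and to the face `C`
of the simplex. -/
theorem close_of_dominant {n : ℕ} [DecidableEq ι] {σ : Finset (Grid ι n)} {C : Finset ι}
    (h : Scarf.Dominant rank σ C) (hC : C.Nonempty) {a : Grid ι n} (ha : a ∈ σ) :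
    (∀ j, j ∉ C → (a.1 j : ℕ) ≤ Fintype.card ι) ∧
      ∀ b ∈ σ, ∀ j, (a.1 j : ℕ) ≤ b.1 j + Fintype.card ι := by
  choose μ hμ hmin using fun i : ι => σ.exists_min_image (fun x => (x.1 i : ℕ)) ⟨a, ha⟩
  have hsum := sum_min_of_dominant h hC hμ
  have hCcard : C.card ≤ Fintype.card ι := Finset.card_le_univ C
  have hoff : ∀ j, j ∉ C → (a.1 j : ℕ) ≤ Fintype.card ι := by
    intro j hj
    have h1 : ∑ i ∈ insert j C, (a.1 i : ℕ) ≤ n := by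
      conv_rhs => rw [← a.2]
      exact Finset.sum_le_sum_of_subset (Finset.subset_univ _)
    rw [Finset.sum_insert hj] at h1
    have h2 : ∑ i ∈ C, ((μ i).1 i : ℕ) ≤ ∑ i ∈ C, (a.1 i : ℕ) :=
      Finset.sum_le_sum fun i _ => hmin i a ha
    omega
  refine ⟨hoff, fun b hb j => ?_⟩
  by_cases hj : j ∈ C
  · have h1 : ∑ i ∈ C, (a.1 i : ℕ) ≤ n := by
      conv_rhs => rw [← a.2]
      exact Finset.sum_le_sum_of_subset (Finset.subset_univ _)
    have h2 : ∑ i ∈ C.erase j, ((μ i).1 i : ℕ) ≤ ∑ i ∈ C.erase j, (a.1 i : ℕ) :=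
      Finset.sum_le_sum fun i _ => hmin i a ha
    rw [← Finset.add_sum_erase _ _ hj] at h1 hsum
    have h3 := hmin j b hb
    omega
  · exact (hoff j hj).trans (Nat.le_add_left _ _)

/-- The point of the simplex represented by a grid point. -/
noncomputable def Grid.point {n : ℕ} (a : Grid ι n) : ι → ℝ := fun i => (a.1 i : ℕ) / n

theorem Grid.point_mem {n : ℕ} (hn : 0 < n) (a : Grid ι n) : a.point ∈ stdSimplex ℝ ι := by
  refine ⟨fun i => by unfold Grid.point; positivity, ?_⟩
  simp only [Grid.point]
  rw [← Finset.sum_div, ← Nat.cast_sum, a.2, div_self (by positivity)]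

theorem exists_coord_le {x y : ι → ℝ} [Nonempty ι] (hx : x ∈ stdSimplex ℝ ι)
    (hy : y ∈ stdSimplex ℝ ι) : ∃ i, x i ≤ y i := by
  by_contra! h
  have := Finset.sum_lt_sum_of_nonempty Finset.univ_nonempty fun i _ => h i
  rw [hx.2, hy.2] at this
  exact lt_irrefl _ this

/-- Scarf's lemma for the grid, a point `a` being coloured by an index whose coordinate `f` does not
decrease. -/
theorem exists_approx [Nonempty ι] {f : (ι → ℝ) → ι → ℝ}
    (hf : Set.MapsTo f (stdSimplex ℝ ι) (stdSimplex ℝ ι)) {n : ℕ} (hn : 0 < n) :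
    ∃ x ∈ stdSimplex ℝ ι, ∀ i, x i ≤ Fintype.card ι / n ∨
      ∃ y ∈ stdSimplex ℝ ι, (∀ j, |x j - y j| ≤ Fintype.card ι / n) ∧ y i ≤ f y i := by
  classical
  have hcol : ∀ a : Grid ι n, ∃ i, a.point i ≤ f a.point i := fun a =>
    exists_coord_le (a.point_mem hn) (hf (a.point_mem hn))
  choose c hc using hcol
  have : Nonempty (Grid ι n) := by
    obtain ⟨i₀⟩ := ‹Nonempty ι›
    refine ⟨⟨fun i => if i = i₀ then Fin.last n else 0, ?_⟩⟩
    simp [apply_ite]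
  obtain ⟨σ, hσ⟩ := Scarf.exists_dominant_colourful (fun i => rank_injective (n := n) i) c
  have hC : (σ.image c).Nonempty := by
    obtain ⟨a⟩ := this
    obtain ⟨i, hi, -⟩ := hσ a
    exact ⟨i, hi⟩
  obtain ⟨a, ha⟩ := Finset.image_nonempty.1 hC
  have hn' : (0 : ℝ) < n := by exact_mod_cast hn
  refine ⟨a.point, a.point_mem hn, fun i => ?_⟩
  by_cases hi : i ∈ σ.image c
  · right
    obtain ⟨b, hb, rfl⟩ := Finset.mem_image.1 hi
    refine ⟨b.point, b.point_mem hn, fun j => ?_, hc b⟩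
    have h1 : ((a.1 j : ℕ) : ℝ) ≤ (b.1 j : ℕ) + Fintype.card ι := by
      exact_mod_cast (close_of_dominant hσ hC ha).2 b hb j
    have h2 : ((b.1 j : ℕ) : ℝ) ≤ (a.1 j : ℕ) + Fintype.card ι := by
      exact_mod_cast (close_of_dominant hσ hC hb).2 a ha j
    simp only [Grid.point]
    rw [← sub_div, abs_div, abs_of_pos hn']
    gcongr
    rw [abs_le]
    constructor <;> linarith
  · left
    have h1 : ((a.1 i : ℕ) : ℝ) ≤ Fintype.card ι := by
      exact_mod_cast (close_of_dominant hσ hC ha).1 i hi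
    simp only [Grid.point]
    gcongr

/-- **Brouwer's fixed point theorem** for the standard simplex. -/
theorem exists_fixedPoint [Nonempty ι] {f : (ι → ℝ) → ι → ℝ}
    (hf : Set.MapsTo f (stdSimplex ℝ ι) (stdSimplex ℝ ι))
    (hcont : ContinuousOn f (stdSimplex ℝ ι)) : ∃ x ∈ stdSimplex ℝ ι, f x = x := by
  have hcpt := isCompact_stdSimplex ℝ ι
  have happrox : ∀ ε > 0, ∃ x ∈ stdSimplex ℝ ι, ∀ i, x i ≤ f x i + ε := by
    intro ε hε
    obtain ⟨δ, hδ, hfδ⟩ := Metric.uniformContinuousOn_iff.1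
      (hcpt.uniformContinuousOn_of_continuous hcont) (ε / 2) (by positivity)
    obtain ⟨n, hn⟩ := exists_nat_gt (Fintype.card ι / min δ (ε / 2))
    have hmin : 0 < min δ (ε / 2) := by positivity
    have hn' : (0 : ℝ) < n := lt_of_le_of_lt (by positivity) hn
    have hsmall : Fintype.card ι / n < min δ (ε / 2) := by
      rw [div_lt_iff₀ hmin] at hn
      rw [div_lt_iff₀ hn']
      linarith
    obtain ⟨x, hx, h⟩ := exists_approx hf (n := n) (by exact_mod_cast hn')
    refine ⟨x, hx, fun i => ?_⟩
    rcases h i with h | ⟨y, hy, hxy, h⟩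
    · have := (hf hx).1 i
      have := min_le_right δ (ε / 2)
      linarith
    · have hd : dist x y < δ := by
        refine (dist_pi_lt_iff hδ).2 fun j => ?_
        rw [Real.dist_eq]
        exact (hxy j).trans_lt (hsmall.trans_le (min_le_left _ _))
      have h1 := (dist_le_pi_dist (f x) (f y) i).trans_lt (hfδ x hx y hy hd)
      rw [Real.dist_eq, abs_lt] at h1
      have h2 := (le_abs_self _).trans (hxy i)
      have := min_le_right δ (ε / 2)
      linarith
  have hφ : ContinuousOn (fun x : ι → ℝ => ∑ i, max (x i - f x i) 0) (stdSimplex ℝ ι) := by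
    refine continuousOn_finsetSum _ fun i _ => ContinuousOn.sup (ContinuousOn.sub ?_ ?_) ?_
    · exact (continuous_apply i).continuousOn
    · exact (continuous_apply i).comp_continuousOn hcont
    · exact continuousOn_const
  obtain ⟨x, hx, hxmin⟩ := hcpt.exists_isMinOn (Set.nonempty_coe_sort.1 inferInstance) hφ
  have hle : ∀ i, x i ≤ f x i := by
    intro i
    refine le_of_forall_pos_le_add fun ε hε => ?_
    have hc : (0 : ℝ) < Fintype.card ι := by exact_mod_cast Fintype.card_pos
    obtain ⟨y, hy, h⟩ := happrox (ε / Fintype.card ι) (by positivity)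
    have h1 : ∑ j, max (x j - f x j) 0 ≤ ∑ j, max (y j - f y j) 0 := hxmin hy
    have h2 : ∑ j, max (y j - f y j) 0 ≤ ∑ _j : ι, ε / Fintype.card ι :=
      Finset.sum_le_sum fun j _ => max_le (by linarith [h j]) (by positivity)
    have h3 : max (x i - f x i) 0 ≤ ∑ j, max (x j - f x j) 0 :=
      Finset.single_le_sum (f := fun j => max (x j - f x j) 0)
        (fun j _ => le_max_right _ _) (Finset.mem_univ i)
    rw [Finset.sum_const, Finset.card_univ, nsmul_eq_mul, mul_div_cancel₀ _ hc.ne'] at h2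
    have := le_max_left (x i - f x i) 0
    linarith
  refine ⟨x, hx, funext fun i => ?_⟩
  exact ((Finset.sum_eq_sum_iff_of_le fun j _ => hle j).1 (by rw [hx.2, (hf hx).2]) i
    (Finset.mem_univ i)).symm

end Brouwer

/-! ### The Gale–Debreu–Nikaido lemma -/

namespace GaleDebreuNikaido

variable {ι : Type*} [Fintype ι]

theorem exists_forall_eq_dotProduct (f : StrongDual ℝ (ι → ℝ)) :
    ∃ p : ι → ℝ, ∀ z, f z = p ⬝ᵥ z := by
  classical
  refine ⟨fun i => f fun j => if i = j then 1 else 0, fun z => ?_⟩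
  have := LinearMap.pi_apply_eq_sum_univ (f : (ι → ℝ) →ₗ[ℝ] ℝ) z
  simp only [ContinuousLinearMap.coe_coe, smul_eq_mul] at this
  rw [this]
  exact Finset.sum_congr rfl fun i _ => mul_comm _ _

theorem continuous_dotProduct_right (q : ι → ℝ) : Continuous fun z : ι → ℝ => q ⬝ᵥ z :=
  continuous_finsetSum _ fun i _ => continuous_const.mul (continuous_apply i)

/-- A compact convex set that does not meet the non-positive orthant lies strictly on the positive
side of a hyperplane with normal vector in the simplex. -/
theorem exists_stdSimplex_forall_pos {Z : Set (ι → ℝ)} (hconv : Convex ℝ Z) (hcpt : IsCompact Z)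
    (hne : Z.Nonempty) (hZ : ∀ z ∈ Z, ¬ z ≤ 0) :
    ∃ q ∈ stdSimplex ℝ ι, ∀ z ∈ Z, 0 < q ⬝ᵥ z := by
  classical
  obtain ⟨f, a, b, hfa, hab, hfb⟩ := geometric_hahn_banach_compact_closed hconv hcpt
    (convex_Iic (0 : ι → ℝ)) isClosed_Iic (Set.disjoint_left.2 fun z hz hz' => hZ z hz hz')
  obtain ⟨p, hp⟩ := exists_forall_eq_dotProduct f
  have hb0 : b < 0 := by simpa using hfb 0 (Set.mem_Iic.2 le_rfl)
  have hp0 : ∀ k, p k ≤ 0 := by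
    intro k
    by_contra! hk
    have h := hfb (Pi.single k (b / p k)) (Set.mem_Iic.2 ?_)
    · rw [hp, dotProduct_single, mul_div_cancel₀ _ hk.ne'] at h
      exact lt_irrefl _ h
    · exact Pi.single_nonpos.2 (div_nonpos_of_nonpos_of_nonneg hb0.le hk.le)
  have hpz : ∀ z ∈ Z, p ⬝ᵥ z < 0 := fun z hz => by
    rw [← hp]
    exact (hfa z hz).trans (hab.trans hb0)
  have hs : ∑ k, p k < 0 := by
    refine lt_of_le_of_ne (Finset.sum_nonpos fun k _ => hp0 k) fun h => ?_
    obtain ⟨z, hz⟩ := hne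
    have h0 := (Finset.sum_eq_zero_iff_of_nonpos fun k _ => hp0 k).1 h
    have hpe : p = 0 := funext fun k => h0 k (Finset.mem_univ k)
    have := hpz z hz
    simp [hpe] at this
  refine ⟨(∑ k, p k)⁻¹ • p, ⟨fun k => ?_, ?_⟩, fun z hz => ?_⟩
  · exact mul_nonneg_of_nonpos_of_nonpos (inv_nonpos.2 hs.le) (hp0 k)
  · simp only [Pi.smul_apply, smul_eq_mul]
    rw [← Finset.mul_sum, inv_mul_cancel₀ hs.ne]
  · rw [smul_dotProduct, smul_eq_mul]
    exact mul_pos_of_neg_of_neg (inv_lt_zero.2 hs) (hpz z hz)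

/-- **Gale–Debreu–Nikaido lemma**: an excess demand correspondence with compact graph and non-empty
convex values that satisfies Walras' law in the weak form `⟨p|z⟩ ≤ 0` has a price at which some
excess demand is non-positive. Otherwise, a continuous map of the simplex, obtained from a
partition of unity, would send each `p` to prices at which all of `Z p` has positive value. -/
theorem exists_nonpos [Nonempty ι] {Z : (ι → ℝ) → Set (ι → ℝ)}
    (hgraph : IsCompact {a : (ι → ℝ) × (ι → ℝ) | a.1 ∈ stdSimplex ℝ ι ∧ a.2 ∈ Z a.1})
    (hconv : ∀ p ∈ stdSimplex ℝ ι, Convex ℝ (Z p))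
    (hne : ∀ p ∈ stdSimplex ℝ ι, (Z p).Nonempty)
    (hwalras : ∀ p ∈ stdSimplex ℝ ι, ∀ z ∈ Z p, p ⬝ᵥ z ≤ 0) :
    ∃ p ∈ stdSimplex ℝ ι, ∃ z ∈ Z p, z ≤ 0 := by
  by_contra! hno
  set G := {a : (ι → ℝ) × (ι → ℝ) | a.1 ∈ stdSimplex ℝ ι ∧ a.2 ∈ Z a.1}
  obtain ⟨g, hg⟩ := exists_continuous_forall_mem_convex_of_local_const
    (X := stdSimplex ℝ ι) (E := ι → ℝ)
    (t := fun p => {q | q ∈ stdSimplex ℝ ι ∧ ∀ z ∈ Z p, 0 < q ⬝ᵥ z})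
    (by
      rintro p q ⟨hq, hqz⟩ r ⟨hr, hrz⟩ a b ha hb hab
      refine ⟨convex_stdSimplex ℝ ι hq hr ha hb hab, fun z hz => ?_⟩
      rw [add_dotProduct, smul_dotProduct, smul_dotProduct, smul_eq_mul, smul_eq_mul]
      have h1 := hqz z hz
      have h2 := hrz z hz
      rcases ha.eq_or_lt with rfl | ha
      · rw [zero_add] at hab
        simpa [hab] using h2
      · exact add_pos_of_pos_of_nonneg (mul_pos ha h1) (mul_nonneg hb h2.le))
    (by
      rintro ⟨p, hp⟩
      have hcpt : IsCompact (Z p) := by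
        have h1 : IsCompact (G ∩ {a | a.1 = p}) :=
          hgraph.inter_right (isClosed_eq continuous_fst continuous_const)
        convert h1.image continuous_snd using 1
        ext z
        constructor
        · exact fun hz => ⟨(p, z), ⟨⟨hp, hz⟩, rfl⟩, rfl⟩
        · rintro ⟨⟨_, _⟩, ⟨⟨-, hz⟩, rfl⟩, rfl⟩
          exact hz
      obtain ⟨q, hq, hqz⟩ := exists_stdSimplex_forall_pos (hconv p hp) hcpt (hne p hp)
        (hno p hp)
      refine ⟨q, ?_⟩
      have h1 : IsCompact (G ∩ {a | q ⬝ᵥ a.2 ≤ 0}) := hgraph.inter_right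
        (isClosed_le ((continuous_dotProduct_right q).comp continuous_snd) continuous_const)
      have h2 := (h1.image continuous_fst).isClosed.isOpen_compl.preimage
        (continuous_subtype_val (p := fun p => p ∈ stdSimplex ℝ ι))
      filter_upwards [h2.mem_nhds (x := ⟨p, hp⟩) (by
        rintro ⟨⟨_, z⟩, ⟨⟨-, hz⟩, hz'⟩, rfl⟩
        exact absurd (hqz z hz) (not_lt.2 hz'))] with r hr
      refine ⟨hq, fun z hz => ?_⟩
      by_contra! hz'
      exact hr ⟨(r.1, z), ⟨⟨r.2, hz⟩, hz'⟩, rfl⟩)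
  classical
  obtain ⟨p, hp, hfix⟩ := Brouwer.exists_fixedPoint
    (f := fun p => if h : p ∈ stdSimplex ℝ ι then g ⟨p, h⟩ else 0)
    (fun p hp => by simpa [hp] using (hg ⟨p, hp⟩).1)
    (by
      rw [continuousOn_iff_continuous_domRestrict]
      convert g.continuous using 1
      ext p
      simp)
  simp only [hp, dif_pos] at hfix
  obtain ⟨z, hz⟩ := hne p hp
  have := (hg ⟨p, hp⟩).2 z hz
  rw [hfix] at this
  exact absurd this (not_lt.2 (hwalras p hp z hz))

end GaleDebreuNikaido

/-! ### Quasi-equilibria -/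

namespace ExchangeEconomy

variable {N K : ℕ} {w : Fin K → ℝ} {u : Fin N → (Fin K → ℝ) → ℝ} {ω x : Fin N → Fin K → ℝ}
  {p : Fin K → ℝ}

/-- With positive income, a bound for the bundles of value below the income extends to all
affordable bundles, since these can be scaled down. -/
theorem le_of_forall_lt_income {v : (Fin K → ℝ) → ℝ} (hv : ContinuousOn v (Set.Ici 0))
    {m c : ℝ} (hm : 0 < m) (h : ∀ y, 0 ≤ y → p ⬝ᵥ y < m → v y ≤ c) {y : Fin K → ℝ} (hy : 0 ≤ y)
    (hpy : p ⬝ᵥ y ≤ m) : v y ≤ c := by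
  have hmem : ∀ᶠ t : ℝ in nhdsWithin 1 (Set.Iio 1), 0 < t ∧ t < 1 := by
    filter_upwards [self_mem_nhdsWithin, nhdsWithin_le_nhds (lt_mem_nhds one_pos)] with t h1 h2
    exact ⟨h2, h1⟩
  have htend : Filter.Tendsto (fun t : ℝ => t • y) (nhdsWithin 1 (Set.Iio 1))
      (nhdsWithin y (Set.Ici 0)) := by
    refine tendsto_nhdsWithin_iff.2 ⟨?_, ?_⟩
    · have : Continuous fun t : ℝ => t • y := by fun_prop
      simpa using (this.tendsto 1).mono_left nhdsWithin_le_nhds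
    · filter_upwards [hmem] with t ht
      exact smul_nonneg ht.1.le hy
  refine le_of_tendsto ((hv y hy).tendsto.comp htend) ?_
  filter_upwards [hmem] with t ht
  refine h _ (smul_nonneg ht.1.le hy) ?_
  rw [dotProduct_smul, smul_eq_mul]
  nlinarith [ht.1, ht.2]

/-- A consumer with a strictly increasing utility function who cannot improve on `x` within the
budget faces positive prices. -/
theorem price_pos_of_optimal {v : (Fin K → ℝ) → ℝ} (hv : StrictMonoOn v (Set.Ici 0))
    (hp : ∀ k, 0 ≤ p k) {z : Fin K → ℝ} (hz : 0 ≤ z) {m : ℝ} (hpz : p ⬝ᵥ z ≤ m)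
    (h : ∀ y, 0 ≤ y → p ⬝ᵥ y ≤ m → v y ≤ v z) (k : Fin K) : 0 < p k := by
  refine (hp k).lt_of_ne fun hk => ?_
  have hlt : z < z + Pi.single k 1 := lt_add_of_pos_right z (Pi.single_pos.2 one_pos)
  refine absurd (h (z + Pi.single k 1) (hz.trans hlt.le) ?_)
    (not_le.2 (hv hz (hz.trans hlt.le) hlt))
  rw [dotProduct_add, dotProduct_single, ← hk, zero_mul, add_zero]
  exact hpz

/-- A quasi-equilibrium, in which a consumer's bundle is only known to be at least as good as every
bundle of value strictly below the income, is a Walrasian equilibrium. Consumers with positive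
income are optimal by continuity; there is one as `w` has positive value, so all prices are positive
and a consumer without income has `0` as the only affordable bundle. -/
theorem isWalrasianEquilibrium_of_quasi (hmono : ∀ i, StrictMonoOn (u i) (Set.Ici 0))
    (hcont : ∀ i, ContinuousOn (u i) (Set.Ici 0)) (hp : p ∈ prices w) (hx : x ∈ feasible w)
    (hωsum : ∑ i, p ⬝ᵥ ω i = 1) (haff : ∀ i, p ⬝ᵥ x i ≤ p ⬝ᵥ ω i)
    (hquasi : ∀ i y, 0 ≤ y → p ⬝ᵥ y < p ⬝ᵥ ω i → u i y ≤ u i (x i)) :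
    IsWalrasianEquilibrium w u ω x p := by
  have hopt : ∀ i, 0 < p ⬝ᵥ ω i → ∀ y, 0 ≤ y → p ⬝ᵥ y ≤ p ⬝ᵥ ω i → u i y ≤ u i (x i) :=
    fun i hi y hy hpy => le_of_forall_lt_income (hcont i) hi (hquasi i) hy hpy
  obtain ⟨i₀, -, hi₀⟩ : ∃ i ∈ Finset.univ, 0 < p ⬝ᵥ ω i :=
    Finset.exists_lt_of_sum_lt (f := fun _ => (0 : ℝ)) (by simp [hωsum])
  have hpos := price_pos_of_optimal (hmono i₀) hp.1 (hx.1 i₀) (haff i₀) (hopt i₀ hi₀)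
  refine ⟨hp, hx, haff, fun i y hy hpy => ?_⟩
  by_cases hi : 0 < p ⬝ᵥ ω i
  · exact hopt i hi y hy hpy
  · have h0 : ∀ k, 0 ≤ p k * y k := fun k => mul_nonneg (hpos k).le (hy k)
    have h1 : ∑ k, p k * y k = 0 :=
      le_antisymm (hpy.trans (not_lt.1 hi)) (Finset.sum_nonneg fun k _ => h0 k)
    have hyx : y ≤ x i := fun k => by
      have := (Finset.sum_eq_zero_iff_of_nonneg fun k _ => h0 k).1 h1 k (Finset.mem_univ k)
      rw [(mul_eq_zero.1 this).resolve_left (hpos k).ne']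
      exact hx.1 i k
    exact (hmono i).monotoneOn hy (hx.1 i) hyx

/-! ### Existence of equilibria -/

/-- The quasi-demand at prices `p` of a consumer with utility `v` and endowment `e`, restricted to
bundles below `b`: affordable bundles at least as good as every bundle of value strictly below the
income. Unlike the demand, it has a closed graph also where the income vanishes. -/
def quasiDemand (b : Fin K → ℝ) (v : (Fin K → ℝ) → ℝ) (e p : Fin K → ℝ) : Set (Fin K → ℝ) :=
  {y | y ∈ Set.Icc 0 b ∧ p ⬝ᵥ y ≤ p ⬝ᵥ e ∧ ∀ z ∈ Set.Icc 0 b, p ⬝ᵥ z < p ⬝ᵥ e → v z ≤ v y}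

variable {b e : Fin K → ℝ} {v : (Fin K → ℝ) → ℝ}

theorem convex_quasiDemand (hv : QuasiconcaveOn ℝ (Set.Ici 0) v) :
    Convex ℝ (quasiDemand b v e p) := by
  rintro y ⟨hyb, hy, hyv⟩ z ⟨hzb, hz, hzv⟩ s t hs ht hst
  refine ⟨convex_Icc 0 b hyb hzb hs ht hst, ?_, fun a ha hpa => ?_⟩
  · rw [dotProduct_add, dotProduct_smul, dotProduct_smul, smul_eq_mul, smul_eq_mul]
    calc s * p ⬝ᵥ y + t * p ⬝ᵥ z ≤ s * p ⬝ᵥ e + t * p ⬝ᵥ e := by gcongr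
      _ = p ⬝ᵥ e := by rw [← add_mul, hst, one_mul]
  · exact (hv (v a) ⟨hyb.1, hyv a ha hpa⟩ ⟨hzb.1, hzv a ha hpa⟩ hs ht hst).2

theorem quasiDemand_nonempty (hv : ContinuousOn v (Set.Ici 0)) (hb : 0 ≤ b)
    (hpe : 0 ≤ p ⬝ᵥ e) : (quasiDemand b v e p).Nonempty := by
  have hcpt : IsCompact (Set.Icc 0 b ∩ {y | p ⬝ᵥ y ≤ p ⬝ᵥ e}) := isCompact_Icc.inter_right
    (isClosed_le (GaleDebreuNikaido.continuous_dotProduct_right p) continuous_const)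
  obtain ⟨y, ⟨hyb, hy⟩, hmax⟩ := hcpt.exists_isMaxOn (f := v)
    ⟨0, ⟨le_rfl, hb⟩, by simpa using hpe⟩ (hv.mono fun y hy => hy.1.1)
  exact ⟨y, hyb, hy, fun z hz hpz => hmax ⟨hz, hpz.le⟩⟩

theorem isClosed_graph_quasiDemand (hv : ContinuousOn v (Set.Ici 0)) :
    IsClosed {a : (Fin K → ℝ) × (Fin K → ℝ) | a.2 ∈ quasiDemand b v e a.1} := by
  have hdot : ∀ z : Fin K → ℝ, Continuous fun a : (Fin K → ℝ) × (Fin K → ℝ) => a.1 ⬝ᵥ z :=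
    fun z => by unfold dotProduct; fun_prop
  have hdot' : Continuous fun a : (Fin K → ℝ) × (Fin K → ℝ) => a.1 ⬝ᵥ a.2 := by
    unfold dotProduct; fun_prop
  have hbox : IsClosed {a : (Fin K → ℝ) × (Fin K → ℝ) | a.2 ∈ Set.Icc 0 b} :=
    isClosed_Icc.preimage continuous_snd
  have hval : ∀ c, IsClosed {a : (Fin K → ℝ) × (Fin K → ℝ) | a.2 ∈ Set.Icc 0 b ∧ c ≤ v a.2} := by
    intro c
    have h1 := (hv.mono (Set.Icc_subset_Ici_self : Set.Icc 0 b ⊆ _)).preimage_isClosed_of_isClosed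
      isClosed_Icc (isClosed_Ici (a := c))
    exact h1.preimage continuous_snd
  have heq : {a : (Fin K → ℝ) × (Fin K → ℝ) | a.2 ∈ quasiDemand b v e a.1} =
      ({a | a.2 ∈ Set.Icc 0 b} ∩ {a | a.1 ⬝ᵥ a.2 ≤ a.1 ⬝ᵥ e}) ∩
        ⋂ z ∈ Set.Icc 0 b, {a | a.1 ⬝ᵥ e ≤ a.1 ⬝ᵥ z} ∪ {a | a.2 ∈ Set.Icc 0 b ∧ v z ≤ v a.2} := by
    ext a
    simp only [quasiDemand, Set.mem_ofPred_eq, Set.mem_inter_iff, Set.mem_iInter, Set.mem_union]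
    constructor
    · rintro ⟨h1, h2, h3⟩
      exact ⟨⟨h1, h2⟩, fun z hz => (le_or_gt _ _).imp_right fun h => ⟨h1, h3 z hz h⟩⟩
    · rintro ⟨⟨h1, h2⟩, h3⟩
      exact ⟨h1, h2, fun z hz h => ((h3 z hz).resolve_left (not_le.2 h)).2⟩
  rw [heq]
  exact (hbox.inter (isClosed_le hdot' (hdot e))).inter
    (isClosed_biInter fun z _ => (isClosed_le (hdot e) (hdot z)).union (hval _))

/-- A quasi-optimal bundle that stays below half of the bound of the truncation is at least as good
as every bundle of value below the income, whether or not the latter respects the bound: otherwise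
moving a little towards that bundle would give an improvement within the bound. -/
theorem le_of_mem_quasiDemand [Nonempty (Fin K)] (hmono : StrictMonoOn v (Set.Ici 0))
    (hqc : QuasiconcaveOn ℝ (Set.Ici 0) v) (hw : ∀ k, 0 < w k) {z : Fin K → ℝ}
    (hz : z ∈ quasiDemand (w + w) v e p) (hzw : z ≤ w) {y : Fin K → ℝ} (hy : 0 ≤ y)
    (hpy : p ⬝ᵥ y < p ⬝ᵥ e) : v y ≤ v z := by
  by_contra! hlt
  obtain ⟨⟨hz0, -⟩, hpz, hopt⟩ := hz
  -- a bundle above `y` whose value is still below the income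
  obtain ⟨c, hc, hpc⟩ : ∃ c : ℝ, 0 < c ∧ p ⬝ᵥ (y + c • 1) < p ⬝ᵥ e := by
    have h1 : Continuous fun c : ℝ => p ⬝ᵥ (y + c • 1) := by unfold dotProduct; fun_prop
    have h2 : ∀ᶠ c in nhdsWithin (0 : ℝ) (Set.Ioi 0), p ⬝ᵥ (y + c • 1) < p ⬝ᵥ e :=
      nhdsWithin_le_nhds (h1.continuousAt.eventually_lt continuousAt_const (by simpa using hpy))
    obtain ⟨c, hc, hc'⟩ := (h2.and self_mem_nhdsWithin).exists
    exact ⟨c, hc', hc⟩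
  set y' := y + c • (1 : Fin K → ℝ)
  have hyy' : y < y' := lt_add_of_pos_right y (smul_pos hc one_pos)
  obtain ⟨t, ht0, ht1, htw⟩ : ∃ t : ℝ, 0 < t ∧ t < 1 ∧ ∀ k, t * y' k < w k := by
    have h1 : ∀ᶠ t in nhdsWithin (0 : ℝ) (Set.Ioi 0), ∀ k, t * y' k < w k := by
      refine nhdsWithin_le_nhds (Filter.eventually_all.2 fun k => ?_)
      have h2 : Continuous fun t : ℝ => t * y' k := by fun_prop
      exact h2.continuousAt.eventually_lt continuousAt_const (by simpa using hw k)
    have h3 : ∀ᶠ t in nhdsWithin (0 : ℝ) (Set.Ioi 0), t < 1 :=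
      nhdsWithin_le_nhds (gt_mem_nhds one_pos)
    obtain ⟨t, ⟨ht, ht1⟩, ht0⟩ := ((h1.and h3).and self_mem_nhdsWithin).exists
    exact ⟨t, ht0, ht1, ht⟩
  have hs : 0 < 1 - t := sub_pos.2 ht1
  have hmix := hqc (v z) ⟨hz0, le_rfl⟩ ⟨hy, hlt.le⟩ hs.le ht0.le (sub_add_cancel 1 t)
  have hlt' : (1 - t) • z + t • y < (1 - t) • z + t • y' := by
    gcongr
  have hmem : 0 ≤ (1 - t) • z + t • y' := hmix.1.trans hlt'.le
  refine absurd (hopt ((1 - t) • z + t • y') ⟨hmem, fun k => ?_⟩ ?_)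
    (not_le.2 (hmix.2.trans_lt (hmono hmix.1 hmem hlt')))
  · have h1 := hzw k
    have h2 := htw k
    have h3 := hz0 k
    simp only [Pi.add_apply, Pi.smul_apply, smul_eq_mul, Pi.zero_apply] at h3 ⊢
    nlinarith
  · rw [dotProduct_add, dotProduct_smul, dotProduct_smul, smul_eq_mul, smul_eq_mul]
    nlinarith

/-- Existence of equilibria: the Gale–Debreu–Nikaido lemma for the quasi-demands truncated at
`w + w`, where a price in the unit simplex is rescaled to give `w` the value one. -/
theorem exists_isWalrasianEquilibrium (hK : 0 < K) (hw : ∀ k, 0 < w k)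
    (hmono : ∀ i, StrictMonoOn (u i) (Set.Ici 0))
    (hqc : ∀ i, QuasiconcaveOn ℝ (Set.Ici 0) (u i))
    (hcont : ∀ i, ContinuousOn (u i) (Set.Ici 0))
    (hω : ∀ i, 0 ≤ ω i) (hωsum : ∑ i, ω i = w) :
    ∃ x p, IsWalrasianEquilibrium w u ω x p := by
  have : Nonempty (Fin K) := ⟨⟨0, hK⟩⟩
  have hw0 : 0 ≤ w := fun k => (hw k).le
  let D : (Fin K → ℝ) → Fin N → Set (Fin K → ℝ) := fun p i => quasiDemand (w + w) (u i) (ω i) p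
  obtain ⟨p, hp, -, ⟨x, hx, rfl⟩, hxw⟩ := GaleDebreuNikaido.exists_nonpos
    (Z := fun p => {z | ∃ x : Fin N → Fin K → ℝ, (∀ i, x i ∈ D p i) ∧ z = ∑ i, x i - w})
    (by
      have hcl : IsClosed {a : (Fin K → ℝ) × (Fin N → Fin K → ℝ) | ∀ i, a.2 i ∈ D a.1 i} := by
        have hi : ∀ i, IsClosed {a : (Fin K → ℝ) × (Fin N → Fin K → ℝ) | a.2 i ∈ D a.1 i} :=
          fun i => (isClosed_graph_quasiDemand (hcont i)).preimage
            (f := fun a : (Fin K → ℝ) × (Fin N → Fin K → ℝ) => (a.1, a.2 i)) (by fun_prop)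
        rw [Set.ofPred_forall]
        exact isClosed_iInter hi
      have hcpt : IsCompact ((stdSimplex ℝ (Fin K) ×ˢ Set.univ.pi fun _ : Fin N =>
          Set.Icc (0 : Fin K → ℝ) (w + w)) ∩ {a | ∀ i, a.2 i ∈ D a.1 i}) :=
        ((isCompact_stdSimplex ℝ (Fin K)).prod
          (isCompact_univ_pi fun _ => isCompact_Icc)).inter_right hcl
      convert hcpt.image (f := fun a => (a.1, ∑ i, a.2 i - w)) (by fun_prop) using 1
      ext ⟨q, z⟩
      constructor
      · rintro ⟨hq, x, hx, rfl⟩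
        exact ⟨(q, x), ⟨⟨hq, fun i _ => (hx i).1⟩, hx⟩, rfl⟩
      · rintro ⟨⟨q', x⟩, ⟨⟨hq, -⟩, hx⟩, h⟩
        obtain ⟨rfl, rfl⟩ := Prod.mk.inj h
        exact ⟨hq, x, hx, rfl⟩)
    (by
      rintro p - _ ⟨x, hx, rfl⟩ _ ⟨y, hy, rfl⟩ s t hs ht hst
      refine ⟨s • x + t • y, fun i => convex_quasiDemand (hqc i) (hx i) (hy i) hs ht hst, ?_⟩
      simp only [Pi.add_apply, Pi.smul_apply, Finset.sum_add_distrib, ← Finset.smul_sum]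
      have h1 : w = s • w + t • w := by rw [← add_smul, hst, one_smul]
      conv_rhs => rw [h1]
      simp only [smul_sub]
      abel)
    (by
      intro p hp
      have hpω : ∀ i, 0 ≤ p ⬝ᵥ ω i := fun i => dotProduct_nonneg_of_nonneg hp.1 (hω i)
      choose x hx using fun i => quasiDemand_nonempty (hcont i) (add_nonneg hw0 hw0) (hpω i)
      exact ⟨_, x, hx, rfl⟩)
    (by
      rintro p - _ ⟨x, hx, rfl⟩
      rw [dotProduct_sub, dotProduct_sum, ← hωsum, dotProduct_sum, sub_nonpos]
      exact Finset.sum_le_sum fun i _ => (hx i).2.1)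
  rw [sub_nonpos] at hxw
  have hpw : 0 < p ⬝ᵥ w := by
    obtain ⟨k, -, hk⟩ : ∃ k ∈ Finset.univ, 0 < p k :=
      Finset.exists_lt_of_sum_lt (f := fun _ => (0 : ℝ)) (by simp [hp.2])
    exact Finset.sum_pos' (fun k _ => mul_nonneg (hp.1 k) (hw0 k))
      ⟨k, Finset.mem_univ k, mul_pos hk (hw k)⟩
  have hinv := inv_pos.2 hpw
  have hsc : ∀ y, ((p ⬝ᵥ w)⁻¹ • p) ⬝ᵥ y = (p ⬝ᵥ w)⁻¹ * p ⬝ᵥ y := fun y => by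
    rw [smul_dotProduct, smul_eq_mul]
  have hxi : ∀ i, x i ≤ w := fun i =>
    (Finset.single_le_sum (f := x) (fun j _ => (hx j).1.1) (Finset.mem_univ i)).trans hxw
  refine ⟨x, (p ⬝ᵥ w)⁻¹ • p, isWalrasianEquilibrium_of_quasi hmono hcont ⟨fun k => ?_, ?_⟩
    ⟨fun i => (hx i).1.1, fun k => ?_⟩ ?_ (fun i => ?_) (fun i y hy hpy => ?_)⟩
  · exact mul_nonneg hinv.le (hp.1 k)
  · rw [hsc, inv_mul_cancel₀ hpw.ne']
  · simpa using hxw k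
  · rw [← dotProduct_sum, hωsum, hsc, inv_mul_cancel₀ hpw.ne']
  · rw [hsc, hsc]
    exact mul_le_mul_of_nonneg_left (hx i).2.1 hinv.le
  · rw [hsc, hsc] at hpy
    exact le_of_mem_quasiDemand (hmono i) (hqc i) hw (hx i) (hxi i) hy
      (lt_of_mul_lt_mul_left hpy hinv.le)

/-! ### The welfare theorems -/

/-- In equilibrium a bundle at least as good as the consumer's own costs at least the income. -/
theorem IsWalrasianEquilibrium.income_le (h : IsWalrasianEquilibrium w u ω x p) (hK : 0 < K)
    (hmono : ∀ i, StrictMonoOn (u i) (Set.Ici 0)) {i : Fin N} {y : Fin K → ℝ} (hy : 0 ≤ y)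
    (huy : u i (x i) ≤ u i y) : p ⬝ᵥ ω i ≤ p ⬝ᵥ y := by
  have : Nonempty (Fin K) := ⟨⟨0, hK⟩⟩
  by_contra! hlt
  have h1 : Continuous fun c : ℝ => p ⬝ᵥ (y + c • 1) := by unfold dotProduct; fun_prop
  have h2 : ∀ᶠ c in nhdsWithin (0 : ℝ) (Set.Ioi 0), p ⬝ᵥ (y + c • 1) < p ⬝ᵥ ω i :=
    nhdsWithin_le_nhds (h1.continuousAt.eventually_lt continuousAt_const (by simpa using hlt))
  obtain ⟨c, hc, hc0⟩ := (h2.and self_mem_nhdsWithin).exists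
  have hlt : y < y + c • (1 : Fin K → ℝ) := lt_add_of_pos_right y (smul_pos hc0 one_pos)
  exact absurd ((h.optimal i _ (hy.trans hlt.le) hc.le).trans huy)
    (not_le.2 (hmono i hy (hy.trans hlt.le) hlt))

theorem IsWalrasianEquilibrium.mem_VPS (h : IsWalrasianEquilibrium w u ω x p) (hK : 0 < K)
    (hmono : ∀ i, StrictMonoOn (u i) (Set.Ici 0)) (hω : ∀ i, 0 ≤ ω i) (hωsum : ∑ i, ω i = w) :
    (fun i => u i (x i)) ∈ VPS w u := by
  refine ⟨p, h.price_mem, fun i => p ⬝ᵥ ω i, ⟨fun i => ?_, ?_⟩, fun i => ⟨?_, ?_⟩⟩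
  · exact dotProduct_nonneg_of_nonneg h.price_mem.1 (hω i)
  · rw [← dotProduct_sum, hωsum, h.price_mem.2]
  · exact ⟨x i, ⟨h.feasible_mem.1 i, le_antisymm (h.affordable i)
      (h.income_le hK hmono (h.feasible_mem.1 i) le_rfl)⟩, rfl⟩
  · rintro _ ⟨y, ⟨hy, hpy⟩, rfl⟩
    exact h.optimal i y hy hpy.le

/-- **First welfare theorem**: a Pareto improvement would cost more than the total income `1`. -/
theorem IsWalrasianEquilibrium.isParetoOptimal (h : IsWalrasianEquilibrium w u ω x p) (hK : 0 < K)
    (hmono : ∀ i, StrictMonoOn (u i) (Set.Ici 0)) (hωsum : ∑ i, ω i = w) :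
    IsParetoOptimal w u x := by
  refine ⟨h.feasible_mem, ⟨x, h.feasible_mem, fun _ => rfl⟩, ?_⟩
  rintro a ⟨y, hy, hay⟩ hle i
  by_contra! hlt
  simp only [hay] at hlt
  have h1 : ∑ j, p ⬝ᵥ ω j < ∑ j, p ⬝ᵥ y j := by
    refine Finset.sum_lt_sum (fun j _ => ?_) ⟨i, Finset.mem_univ i, ?_⟩
    · exact h.income_le hK hmono (hy.1 j) (hay j ▸ hle j)
    · by_contra! hle'
      exact absurd (h.optimal i (y i) (hy.1 i) hle') (not_le.2 hlt)
  rw [← dotProduct_sum, ← dotProduct_sum, hωsum] at h1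
  refine absurd (dotProduct_le_dotProduct_of_nonneg_left (fun k => ?_) h.price_mem.1)
    (not_le.2 h1)
  simpa using hy.2 k

/-- The total bundles that leave a surplus of every good after giving each consumer `i` a bundle at
least as good as `x i`. -/
def improvable (u : Fin N → (Fin K → ℝ) → ℝ) (x : Fin N → Fin K → ℝ) : Set (Fin K → ℝ) :=
  {z | ∃ y : Fin N → Fin K → ℝ, (∀ i, 0 ≤ y i ∧ u i (x i) ≤ u i (y i)) ∧ ∀ k, (∑ i, y i) k < z k}

theorem isOpen_improvable : IsOpen (improvable u x) := by
  rw [isOpen_iff_mem_nhds]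
  rintro z ⟨y, hy, hyz⟩
  have h1 : ∀ᶠ z' : Fin K → ℝ in nhds z, ∀ k, (∑ i, y i) k < z' k :=
    Filter.eventually_all.2 fun k =>
      continuousAt_const.eventually_lt (continuous_apply k).continuousAt (hyz k)
  filter_upwards [h1] with z' hz'
  exact ⟨y, hy, hz'⟩

theorem convex_improvable (hqc : ∀ i, QuasiconcaveOn ℝ (Set.Ici 0) (u i)) :
    Convex ℝ (improvable u x) := by
  rintro z ⟨y, hy, hyz⟩ z' ⟨y', hy', hyz'⟩ s t hs ht hst
  refine ⟨s • y + t • y', fun i => hqc i _ (hy i) (hy' i) hs ht hst, fun k => ?_⟩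
  simp only [Pi.add_apply, Pi.smul_apply, Finset.sum_add_distrib, ← Finset.smul_sum, smul_eq_mul]
  have h1 := hyz k
  have h2 := hyz' k
  rcases hs.eq_or_lt with rfl | hs
  · rw [zero_add] at hst
    simpa [hst] using h2
  · exact add_lt_add_of_lt_of_le (mul_lt_mul_of_pos_left h1 hs)
      (mul_le_mul_of_nonneg_left h2.le ht)

/-- Handing the surplus to a single consumer would be a Pareto improvement. -/
theorem IsParetoOptimal.notMem_improvable (h : IsParetoOptimal w u x) (hN : 0 < N) (hK : 0 < K)
    (hmono : ∀ i, StrictMonoOn (u i) (Set.Ici 0)) : w ∉ improvable u x := by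
  rintro ⟨y, hy, hyw⟩
  let i₀ : Fin N := ⟨0, hN⟩
  set r := w - ∑ i, y i
  have hr : 0 < r := by
    refine lt_of_le_of_ne (fun k => sub_nonneg.2 (hyw k).le) fun h => ?_
    have h1 := congrFun h ⟨0, hK⟩
    exact absurd h1 (sub_pos.2 (hyw ⟨0, hK⟩)).ne
  set y' : Fin N → Fin K → ℝ := y + Pi.single i₀ r
  have hyy' : y ≤ y' := le_add_of_nonneg_right (Pi.single_nonneg.2 hr.le)
  have hy'0 : ∀ i, 0 ≤ y' i := fun i => (hy i).1.trans (hyy' i)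
  have hy'w : ∑ i, y' i = w := by
    simp only [y', Pi.add_apply, Finset.sum_add_distrib, Finset.sum_pi_single', Finset.mem_univ,
      if_true, r]
    exact add_sub_cancel _ _
  have hmem : (fun i => u i (y' i)) ∈ UPS w u :=
    ⟨y', ⟨hy'0, fun k => by rw [← hy'w, Finset.sum_apply]⟩, fun _ => rfl⟩
  have hlt : y i₀ < y' i₀ := by
    simp only [y', Pi.add_apply, Pi.single_eq_same]
    exact lt_add_of_pos_right _ hr
  have h1 := h.2.2 hmem
    (fun i => (hy i).2.trans ((hmono i).monotoneOn (hy i).1 (hy'0 i) (hyy' i))) i₀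
  exact absurd (h1.trans (hy i₀).2) (not_le.2 (hmono i₀ (hy i₀).1 (hy'0 i₀) hlt))

/-- Supporting prices at a Pareto optimal allocation, from a hyperplane that separates `w` from the
open convex set `improvable u x`. -/
theorem IsParetoOptimal.exists_support (h : IsParetoOptimal w u x) (hN : 0 < N) (hK : 0 < K)
    (hw : ∀ k, 0 < w k) (hmono : ∀ i, StrictMonoOn (u i) (Set.Ici 0))
    (hqc : ∀ i, QuasiconcaveOn ℝ (Set.Ici 0) (u i)) :
    ∃ p ∈ prices w, ∀ y : Fin N → Fin K → ℝ, (∀ i, 0 ≤ y i ∧ u i (x i) ≤ u i (y i)) →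
      1 ≤ p ⬝ᵥ ∑ i, y i := by
  have : Nonempty (Fin K) := ⟨⟨0, hK⟩⟩
  obtain ⟨f, hf⟩ := geometric_hahn_banach_point_open (convex_improvable hqc) isOpen_improvable
    (h.notMem_improvable hN hK hmono)
  obtain ⟨p, hp⟩ := GaleDebreuNikaido.exists_forall_eq_dotProduct f
  simp only [hp] at hf
  have hup : ∀ y : Fin N → Fin K → ℝ, (∀ i, 0 ≤ y i ∧ u i (x i) ≤ u i (y i)) →
      p ⬝ᵥ w ≤ p ⬝ᵥ ∑ i, y i := by
    intro y hy
    have h1 : Continuous fun c : ℝ => p ⬝ᵥ (∑ i, y i + c • 1) := by unfold dotProduct; fun_prop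
    have h2 : Filter.Tendsto (fun c : ℝ => p ⬝ᵥ (∑ i, y i + c • 1)) (nhdsWithin 0 (Set.Ioi 0))
        (nhds (p ⬝ᵥ ∑ i, y i)) := by
      simpa using (h1.tendsto 0).mono_left nhdsWithin_le_nhds
    refine ge_of_tendsto h2 ?_
    filter_upwards [self_mem_nhdsWithin] with c hc
    refine (hf _ ⟨y, hy, fun k => ?_⟩).le
    simpa using hc
  have hxw : ∑ i, x i ≤ w := fun k => by simpa using h.1.2 k
  have hxx : ∀ i, 0 ≤ x i ∧ u i (x i) ≤ u i (x i) := fun i => ⟨h.1.1 i, le_rfl⟩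
  -- `w` with one more unit of good `k` is a limit of points of `improvable u x`
  have hp0 : ∀ k, 0 ≤ p k := by
    intro k
    have h1 : Continuous fun c : ℝ => p ⬝ᵥ (w + Pi.single k 1 + c • 1) := by
      unfold dotProduct; fun_prop
    have h2 : Filter.Tendsto (fun c : ℝ => p ⬝ᵥ (w + Pi.single k 1 + c • 1))
        (nhdsWithin 0 (Set.Ioi 0)) (nhds (p ⬝ᵥ (w + Pi.single k 1))) := by
      simpa using (h1.tendsto 0).mono_left nhdsWithin_le_nhds
    have h3 : p ⬝ᵥ w ≤ p ⬝ᵥ (w + Pi.single k 1) := by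
      refine ge_of_tendsto h2 ?_
      filter_upwards [self_mem_nhdsWithin] with c hc
      refine (hf _ ⟨x, hxx, fun l => ?_⟩).le
      have h4 := hxw l
      have h5 : (0 : Fin K → ℝ) l ≤ (Pi.single k 1 : Fin K → ℝ) l :=
        (Pi.single_nonneg (i := k)).2 zero_le_one l
      have h6 : 0 < c := hc
      simp only [Pi.add_apply, Pi.smul_apply, Pi.one_apply, Pi.zero_apply, smul_eq_mul, mul_one]
        at h5 ⊢
      linarith
    rw [dotProduct_add, dotProduct_single, mul_one] at h3
    linarith
  have hpne : ∃ k, p k ≠ 0 := by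
    by_contra! h0
    have hpe : p = 0 := funext h0
    have h1 := hf (w + 1) ⟨x, hxx, fun k => (hxw k).trans_lt (by simp)⟩
    simp [hpe] at h1
  obtain ⟨k, hk⟩ := hpne
  have hpw : 0 < p ⬝ᵥ w := Finset.sum_pos' (fun k _ => mul_nonneg (hp0 k) (hw k).le)
    ⟨k, Finset.mem_univ k, mul_pos ((hp0 k).lt_of_ne' hk) (hw k)⟩
  refine ⟨(p ⬝ᵥ w)⁻¹ • p, ⟨fun k => mul_nonneg (inv_pos.2 hpw).le (hp0 k), ?_⟩, fun y hy => ?_⟩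
  · rw [smul_dotProduct, smul_eq_mul, inv_mul_cancel₀ hpw.ne']
  · rw [smul_dotProduct, smul_eq_mul, ← inv_mul_cancel₀ hpw.ne']
    exact mul_le_mul_of_nonneg_left (hup y hy) (inv_pos.2 hpw).le

/-- **Second welfare theorem**: incomes are the values of the bundles at supporting prices, and
replacing a single bundle shows that these form a quasi-equilibrium. -/
theorem IsParetoOptimal.exists_isWalrasianEquilibrium (h : IsParetoOptimal w u x) (hN : 0 < N)
    (hK : 0 < K) (hw : ∀ k, 0 < w k) (hmono : ∀ i, StrictMonoOn (u i) (Set.Ici 0))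
    (hqc : ∀ i, QuasiconcaveOn ℝ (Set.Ici 0) (u i))
    (hcont : ∀ i, ContinuousOn (u i) (Set.Ici 0)) :
    ∃ m ∈ stdSimplex ℝ (Fin N), ∃ p, IsWalrasianEquilibrium w u (fun i => m i • w) x p := by
  obtain ⟨p, hp, hsup⟩ := h.exists_support hN hK hw hmono hqc
  have hxx : ∀ i, 0 ≤ x i ∧ u i (x i) ≤ u i (x i) := fun i => ⟨h.1.1 i, le_rfl⟩
  have hsum : ∑ i, p ⬝ᵥ x i = 1 := by
    rw [← dotProduct_sum]
    refine le_antisymm ?_ (hsup x hxx)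
    rw [← hp.2]
    exact dotProduct_le_dotProduct_of_nonneg_left (fun k => by simpa using h.1.2 k) hp.1
  have hinc : ∀ i, p ⬝ᵥ ((p ⬝ᵥ x i) • w) = p ⬝ᵥ x i := fun i => by
    rw [dotProduct_smul, hp.2, smul_eq_mul, mul_one]
  refine ⟨fun i => p ⬝ᵥ x i, ⟨fun i => dotProduct_nonneg_of_nonneg hp.1 (h.1.1 i), hsum⟩, p,
    isWalrasianEquilibrium_of_quasi hmono hcont hp h.1 ?_ (fun i => (hinc i).ge) ?_⟩
  · simpa only [hinc] using hsum
  · intro i y hy hpy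
    rw [hinc] at hpy
    by_contra! hlt
    -- replacing the bundle of consumer `i` by `y` would cost less than `1`
    have h1 := hsup (Function.update x i y) (fun j => by
      by_cases hj : j = i
      · subst hj; simpa using ⟨hy, hlt.le⟩
      · simpa [hj] using hxx j)
    rw [dotProduct_sum, ← hsum] at h1
    refine absurd h1 (not_le.2 (Finset.sum_lt_sum (fun j _ => ?_) ⟨i, Finset.mem_univ i, ?_⟩))
    · by_cases hj : j = i
      · subst hj; simpa using hpy.le
      · simp [hj]
    · simpa using hpy

end ExchangeEconomy

/-! ### Equilibria, Pareto optima and utility possibilities -/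

theorem corollary2 {N K : ℕ} (hN : 0 < N) (hK : 0 < K)
    (w : Fin K → ℝ) (hw : ∀ k, 0 < w k)
    (u : Fin N → (Fin K → ℝ) → ℝ)
    (hmono : ∀ i, StrictMonoOn (u i) (Set.Ici 0))
    (hqc : ∀ i, QuasiconcaveOn ℝ (Set.Ici 0) (u i))
    (hcont : ∀ i, ContinuousOn (u i) (Set.Ici 0))
    (hdiff : ∀ i, DifferentiableOn ℝ (u i) {x | ∀ k, 0 < x k}) :
    (∀ ω : Fin N → Fin K → ℝ, (∀ i k, 0 ≤ ω i k) → (∀ k, ∑ i, ω i k = w k) →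
      (∃ x p, ExchangeEconomy.IsWalrasianEquilibrium w u ω x p) ∧
      ∀ x p, ExchangeEconomy.IsWalrasianEquilibrium w u ω x p →
        (fun i => u i (x i)) ∈ ExchangeEconomy.UPS w u ∩ ExchangeEconomy.VPS w u ∧
        ExchangeEconomy.IsParetoOptimal w u x) ∧
    (∀ x : Fin N → Fin K → ℝ, ExchangeEconomy.IsParetoOptimal w u x →
      ∃ m ∈ stdSimplex ℝ (Fin N), ∃ p,
        ExchangeEconomy.IsWalrasianEquilibrium w u (fun i => m i • w) x p) := by
  refine ⟨fun ω hω hsum => ?_,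
    fun x hx => hx.exists_isWalrasianEquilibrium hN hK hw hmono hqc hcont⟩
  have hωsum : ∑ i, ω i = w := funext fun k => by rw [Finset.sum_apply, hsum k]
  refine ⟨ExchangeEconomy.exists_isWalrasianEquilibrium hK hw hmono hqc hcont hω hωsum,
    fun x p h => ?_⟩
  exact ⟨⟨⟨x, h.feasible_mem, fun _ => rfl⟩, h.mem_VPS hK hmono hω hωsum⟩,
    h.isParetoOptimal hK hmono hωsum⟩
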